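/- A weighted graph $(V,c)$ is a set $V$ with a weight function $c:V\times V\to\mathbb R_{\ge 0}$ satisfying $c(x,x)=0$ and $c(x,y)=c(y,x)$; write $c_x:=\sum_{y}c(x,y)\in[0,\infty]$, call $x,y$ adjacent if $c(x,y)>0$, and put $\mathcal E(u):=\frac12\sum_{x,y}c(x,y)(u(x)-u(y))^2\in[0,\infty]$ for $u:V\to\mathbb R$. The effective resistance of a finite connected weighted graph is $(x,y)\mapsto\phi^{xy}(x)$, where $\phi^{xy}$ is the solution of $\Delta\phi=\frac1{c_x}\mathbf 1_x-\frac1{c_y}\mathbf 1_y$, $\phi(y)=0$, with $(\Delta f)(z)=f(z)-\sum_w\frac{c(z,w)}{c_z}f(w)$. A Dirichlet form on a finite set $W$ is a quadratic form $\mathcal F\ge 0$ on $\mathbb R^W$ that vanishes exactly on the constant functions and satisfies $\mathcal F(\min\{1,\max\{u,0\}\})\le\mathcal F(u)$ for all $u$. A function $R:V\times V\to\mathbb R_{\ge0}$ is a resistance metric if for every finite $W\subseteq V$ there is a Dirichlet form $\mathcal F$ on $W$ such that for all $x,y\in W$ one has $R(x,y)=\left(\min\{\mathcal F(u): u(x)=1,\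 u(y)=0\}\right)^{-1}$ (read as $0$ if $x=y$). Let $V$ be a countably infinite set, $R$ a resistance metric on $V$, and $(V_n)_{n\in\mathbb N}$ an increasing sequence of finite subsets of $V$ with union $V$. For each $n$ let $G_n=(V_n,c_n)$ be the connected weighted graph whose effective resistance is $R|_{V_n\times V_n}$, and let $G_R=(V,c)$, $c(x,y)=\lim_{n\to\infty}c_n(x,y)$, be the limit graph. Suppose that for all $v\in V$ $$c_v=\sum_{y\in V}c(v,y)=\lim_{n\to\infty}(c_n)_v<\infty ,$$ and that $G_R$ is recurrent, i.e. for every $x\in V$ the random walk on $G_R$ started in $x$ (which jumps from $y$ to $z$ with probability $c(y,z)/c_y$) almost surely returns to $x$. Then $R$ is the effective resistance of $G_R$: for all $x,y\in V$, $$R(x,y)=\left(\inf\{\mathcal E(u): \mathcal E(u)<\infty,\ u(x)=1,\ u(y)=0\}\right)^{-1}=\left(\inf\{\mathcal E(u): u\in\mathcal Fin,\ u(x)=1,\ u(y)=0\}\right)^{-1},$$ where $\mathcal E$ is the energy of $G_R$, $\mathcal Fin$ is the set of functions $V\to\mathbb R$ that are constant outside of a finite set, and $\inf\emptyset=\infty$,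 $\infty^{-1}=0$. That is, $R$ equals both the free and the wired effective resistance of $G_R$. -/

import Mathlib

open Filter Topology MeasureTheory ProbabilityTheory
open scoped NNReal ENNReal

noncomputable section

/-- A weighted graph on the vertex set `V`: symmetric nonnegative edge weights, no self-loops. -/
structure WeightedGraph (V : Type*) where
  weight : V → V → ℝ≥0
  weight_self : ∀ x, weight x x = 0
  weight_symm : ∀ x y, weight x y = weight y x

namespace WeightedGraph

variable {V : Type*}

/-- The vertex weight `c_x = ∑ y, c(x, y)`, possibly infinite. -/
def vertexWeight (G : WeightedGraph V) (x : V) : ℝ≥0∞ :=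
  ∑' y, (G.weight x y : ℝ≥0∞)

/-- `x` and `y` are adjacent if `c(x, y) > 0`. -/
def Adj (G : WeightedGraph V) (x y : V) : Prop := 0 < G.weight x y

/-- Any two vertices are joined by a path of edges of positive weight. -/
def Connected (G : WeightedGraph V) : Prop :=
  ∀ x y, Relation.ReflTransGen G.Adj x y

section Finite

/-- The Laplacian `(Δ f)(x) = f(x) - ∑ y, c(x, y) / c_x * f(y)` of a finite graph. -/
def laplacian [Fintype V] (G : WeightedGraph V) (f : V → ℝ) (x : V) : ℝ :=
  f x - ∑ y, (G.weight x y : ℝ) / (G.vertexWeight x).toReal * f y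

/-- `φ` solves the discrete Dirichlet problem
`Δ φ = (1 / c_x) 1_x - (1 / c_y) 1_y`, `φ(y) = 0`. -/
def IsDirichletSolution [Fintype V] (G : WeightedGraph V) (x y : V) (φ : V → ℝ) : Prop :=
  (∀ z, G.laplacian φ z =
      1 / (G.vertexWeight x).toReal * Set.indicator {x} 1 z
        - 1 / (G.vertexWeight y).toReal * Set.indicator {y} 1 z) ∧
    φ y = 0

/-- `R` is the effective resistance of the finite graph `G`: `R(x, y) = φ^{xy}(x)` where `φ^{xy}`
is the solution (unique if `G` is connected) of the Dirichlet problem. -/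
def IsEffectiveResistance [Fintype V] (G : WeightedGraph V) (R : V → V → ℝ≥0) : Prop :=
  ∀ x y, ∃ φ : V → ℝ, G.IsDirichletSolution x y φ ∧ (R x y : ℝ) = φ x

end Finite

section Limit

open scoped Classical in
/-- A weighted graph on a finite set `s` of vertices, regarded as a weighted graph on `V` by giving
weight zero to all pairs that are not contained in `s`. -/
def extend {s : Finset V} (G : WeightedGraph s) : WeightedGraph V where
  weight x y := if h : x ∈ s ∧ y ∈ s then G.weight ⟨x, h.1⟩ ⟨y, h.2⟩ else 0
  weight_self x := by
    split_ifs with h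
    · exact G.weight_self _
    · rfl
  weight_symm x y := by
    by_cases h : x ∈ s ∧ y ∈ s
    · rw [dif_pos h, dif_pos h.symm]
      exact G.weight_symm _ _
    · rw [dif_neg h, dif_neg fun h' => h h'.symm]

/-- The weighted graph with edge weights `c(x, y) = lim_n c_n(x, y)`. -/
def limitGraph (H : ℕ → WeightedGraph V) : WeightedGraph V where
  weight x y := limUnder atTop fun n => (H n).weight x y
  weight_self x := by
    simp only [weight_self]
    exact tendsto_const_nhds.limUnder_eq
  weight_symm x y := by
    simp only [fun n => (H n).weight_symm x y]

end Limit

section Energy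

/-- The energy form `E(u) = 1/2 ∑ x, ∑ y, c(x, y) (u(x) - u(y))²`, possibly infinite. -/
def energy (G : WeightedGraph V) (u : V → ℝ) : ℝ≥0∞ :=
  2⁻¹ * ∑' x, ∑' y, (G.weight x y : ℝ≥0∞) * ENNReal.ofReal ((u x - u y) ^ 2)

/-- The functions of finite energy. -/
def domEnergy (G : WeightedGraph V) : Set (V → ℝ) := {u | G.energy u < ⊤}

/-- The functions that are constant outside of a finite set. -/
def finFun (V : Type*) : Set (V → ℝ) :=
  {u | ∃ k : ℝ, ∃ W : Set V, W.Finite ∧ ∀ x ∉ W, u x = k}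

/-- `(inf {E(u) | u ∈ D, u(x) = 1, u(y) = 0})⁻¹`. For `x = y` the infimum over the empty set is `∞`
and the value is `0`. -/
def resistanceOn (G : WeightedGraph V) (D : Set (V → ℝ)) (x y : V) : ℝ≥0∞ :=
  (sInf (G.energy '' {u | u ∈ D ∧ u x = 1 ∧ u y = 0}))⁻¹

/-- The free effective resistance of a (possibly infinite) graph. -/
def freeResistance (G : WeightedGraph V) : V → V → ℝ≥0∞ :=
  G.resistanceOn G.domEnergy

/-- The wired effective resistance of a (possibly infinite) graph. -/
def wiredResistance (G : WeightedGraph V) : V → V → ℝ≥0∞ :=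
  G.resistanceOn (finFun V)

end Energy

section RandomWalk

open scoped Classical in
/-- The law of one step of the random walk from `x`: the walk jumps to `y` with probability
`c(x, y) / c_x`. By convention, it stays at `x` if `c_x` is `0` or `∞`. -/
def step (G : WeightedGraph V) (x : V) : PMF V :=
  if h : (∑' y, (G.weight x y : ℝ≥0∞)) ≠ 0 ∧ (∑' y, (G.weight x y : ℝ≥0∞)) ≠ ⊤ then
    PMF.normalize (fun y => (G.weight x y : ℝ≥0∞)) h.1 h.2
  else PMF.pure x

variable [MeasurableSpace V] [DiscreteMeasurableSpace V]

/-- The transition kernel of the random walk. -/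
def stepKernel (G : WeightedGraph V) : Kernel V V where
  toFun x := (G.step x).toMeasure
  measurable' := Measurable.of_discrete

instance (G : WeightedGraph V) : IsMarkovKernel G.stepKernel :=
  ⟨fun x => inferInstanceAs (IsProbabilityMeasure (G.step x).toMeasure)⟩

/-- The transition kernel from the history `(ω_0, …, ω_n)` to `ω_{n+1}`, which only depends on
`ω_n`. -/
def historyKernel (G : WeightedGraph V) (n : ℕ) : Kernel (Finset.Iic n → V) V :=
  G.stepKernel.comap (fun ω => ω ⟨n, Finset.mem_Iic.2 le_rfl⟩) (measurable_pi_apply _)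

instance (G : WeightedGraph V) (n : ℕ) : IsMarkovKernel (G.historyKernel n) :=
  inferInstanceAs (IsMarkovKernel (G.stepKernel.comap _ _))

/-- The law `P_x`, on the space `V^ℕ` of trajectories, of the random walk on `G` started in `x`. -/
def randomWalk (G : WeightedGraph V) (x : V) : Measure (ℕ → V) :=
  Kernel.traj (X := fun _ => V) G.historyKernel 0 (fun _ => x)

/-- The random walk is recurrent: started anywhere, it almost surely returns to its starting point,
that is, `P_x[τ_x⁺ < ∞] = 1` for all `x`. -/
def IsRecurrent (G : WeightedGraph V) : Prop :=
  ∀ x, ∀ᵐ ω ∂(G.randomWalk x), ∃ k, 1 ≤ k ∧ ω k = x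

end RandomWalk

end WeightedGraph

/-- A Dirichlet form on a finite set `W`. -/
structure IsDirichletForm {W : Type*} (F : QuadraticForm ℝ (W → ℝ)) : Prop where
  nonneg : ∀ u, 0 ≤ F u
  eq_zero_iff : ∀ u, F u = 0 ↔ ∃ k : ℝ, ∀ x, u x = k
  markov : ∀ u : W → ℝ, F (fun x => min 1 (max (u x) 0)) ≤ F u

/-- `R_F(x, y) = (min {F(u) | u(x) = 1, u(y) = 0})⁻¹`. For `x = y` the set is empty and the value
is `0`. -/
def dirichletResistance {W : Type*} (F : QuadraticForm ℝ (W → ℝ)) (x y : W) : ℝ :=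
  (sInf (F '' {u | u x = 1 ∧ u y = 0}))⁻¹

/-- `R` is a resistance metric on `X`: on each finite subset it is induced by a Dirichlet form. -/
def IsResistanceMetric {X : Type*} (R : X → X → ℝ≥0) : Prop :=
  ∀ W : Finset X, ∃ F : QuadraticForm ℝ (W → ℝ), IsDirichletForm F ∧
    ∀ x y : W, (R x y : ℝ) = dirichletResistance F x y

/-- A finite exhaustion of `V`. -/
structure IsFiniteExhaustion {V : Type*} (Vn : ℕ → Finset V) : Prop where
  mono : ∀ n, Vn n ⊆ Vn (n + 1)
  exhausts : ∀ x, ∃ n, x ∈ Vn n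

end

/-! Write `φ(z) = (R(x,y) + R(z,y) - R(x,z)) / 2`. In every `G_n` with `x, y ∈ V_n` the restriction
of `φ` is the potential of the unit flow from `x` to `y`, by uniqueness, reciprocity and
superposition (`IsEffectiveResistance.isDirichletSolution_eq`). Thus one function on `V` serves all
`n`. The theorem is the chain `1/R(x,y) ≤ wired infimum ≤ free infimum ≤ 1/R(x,y)`.

Last inequality: `φ / R(x,y)` has energy `1/R(x,y)` in each such `G_n`, hence at most that in the
limit by Fatou (`energy_le_of_tendsto`). First inequality: on functions constant outside a finite
set, convergence of the edge and vertex weights carries lower bounds on the energy to the limit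
(`le_energy_of_tendsto`), and `1/R(x,y)` is the minimal energy in `G_n`
(`IsEffectiveResistance.inv_le_energyForm`).

Middle inequality: recurrence gives finitely supported `f_k` with `f_k(x) = 1` and energy tending to
`0` (`exists_finite_support_tendsto_energy`). Multiplying a truncated competitor by `f_k` makes it
finitely supported at vanishing cost (`sInf_energy_finFun_le`). -/

namespace WeightedGraph

/-! ### Energy identities and comparison on arbitrary graphs -/

section Energy

variable {V : Type*} (G : WeightedGraph V)

/-- Expansion of the energy; negative terms are moved to the other side. -/
lemma energy_add_tsum {u g : V → ℝ} {k : ℝ} (hu : ∀ z, u z = g z + k) :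
    G.energy u + ∑' z, ∑' w, (G.weight z w : ℝ≥0∞) * ENNReal.ofReal (g z * g w) =
      ∑' z, G.vertexWeight z * ENNReal.ofReal (g z ^ 2) +
        ∑' z, ∑' w, (G.weight z w : ℝ≥0∞) * ENNReal.ofReal (-(g z * g w)) := by
  set T := ∑' z, ∑' w, (G.weight z w : ℝ≥0∞) * ENNReal.ofReal (g z * g w) with hT
  set N := ∑' z, ∑' w, (G.weight z w : ℝ≥0∞) * ENNReal.ofReal (-(g z * g w)) with hN
  have hQ : ∑' z, G.vertexWeight z * ENNReal.ofReal (g z ^ 2) =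
      ∑' z, ∑' w, (G.weight z w : ℝ≥0∞) * ENNReal.ofReal (g z ^ 2) :=
    tsum_congr fun z => by rw [vertexWeight, ENNReal.tsum_mul_right]
  have hQ' : ∑' z, G.vertexWeight z * ENNReal.ofReal (g z ^ 2) =
      ∑' z, ∑' w, (G.weight z w : ℝ≥0∞) * ENNReal.ofReal (g w ^ 2) := by
    rw [hQ, ENNReal.tsum_comm]
    exact tsum_congr fun z => tsum_congr fun w => by rw [G.weight_symm]
  -- The constant `k` cancels in differences. The cross term `g z * g w` is split into positive and
  -- negative parts, one of which is always zero, to avoid subtraction in `ℝ≥0∞`.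
  have hpt : ∀ z w, ENNReal.ofReal ((u z - u w) ^ 2) +
      (ENNReal.ofReal (g z * g w) + ENNReal.ofReal (g z * g w)) =
      ENNReal.ofReal (g z ^ 2) + ENNReal.ofReal (g w ^ 2) +
      (ENNReal.ofReal (-(g z * g w)) + ENNReal.ofReal (-(g z * g w))) := by
    intro z w
    rw [hu z, hu w]
    rcases le_total 0 (g z * g w) with h | h
    · rw [ENNReal.ofReal_of_nonpos (neg_nonpos.2 h)]
      rw [← ENNReal.ofReal_add h h, ← ENNReal.ofReal_add (by positivity) (by positivity),
        ← ENNReal.ofReal_add (by positivity) (by positivity), add_zero, add_zero]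
      congr 1
      ring
    · rw [ENNReal.ofReal_of_nonpos h]
      have h' := neg_nonneg.2 h
      rw [← ENNReal.ofReal_add h' h', ← ENNReal.ofReal_add (by positivity) (by positivity),
        ← ENNReal.ofReal_add (by positivity) (by linarith), add_zero, add_zero]
      congr 1
      ring
  have hsum : (∑' z, ∑' w, (G.weight z w : ℝ≥0∞) * ENNReal.ofReal ((u z - u w) ^ 2)) + (T + T) =
      (∑' z, G.vertexWeight z * ENNReal.ofReal (g z ^ 2) +
        ∑' z, G.vertexWeight z * ENNReal.ofReal (g z ^ 2)) + (N + N) := by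
    nth_rw 1 [hQ]
    rw [hQ', hT, hN]
    simp only [← ENNReal.tsum_add, ← mul_add, hpt]
  have h2 : ∀ a : ℝ≥0∞, 2⁻¹ * (a + a) = a := fun a => by
    rw [← two_mul, ← mul_assoc, ENNReal.inv_mul_cancel (by simp) (by simp), one_mul]
  have := congrArg (fun a => 2⁻¹ * a) hsum
  simpa only [energy, mul_add (2⁻¹ : ℝ≥0∞) _ (T + T), h2, mul_add (2⁻¹ : ℝ≥0∞) _ (N + N)] using this

/-- Serves both truncation (`a = 1`, `b = 0`) and the Leibniz-type estimate for products. -/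
lemma energy_le_mul_add_mul {u v w : V → ℝ} {a b : ℝ≥0}
    (h : ∀ z z', (u z - u z') ^ 2 ≤ a * (v z - v z') ^ 2 + b * (w z - w z') ^ 2) :
    G.energy u ≤ a * G.energy v + b * G.energy w := by
  simp only [energy]
  rw [mul_left_comm, mul_left_comm (b : ℝ≥0∞), ← mul_add]
  refine mul_le_mul_right ?_ _
  simp only [← ENNReal.tsum_mul_left, ← ENNReal.tsum_add]
  refine ENNReal.tsum_le_tsum fun z => ENNReal.tsum_le_tsum fun z' => ?_
  rw [mul_left_comm, mul_left_comm (b : ℝ≥0∞), ← mul_add]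
  refine mul_le_mul_right ?_ _
  refine (ENNReal.ofReal_le_ofReal (h z z')).trans (le_of_eq ?_)
  rw [ENNReal.ofReal_add (by positivity) (by positivity), ENNReal.ofReal_mul a.coe_nonneg,
    ENNReal.ofReal_mul b.coe_nonneg, ENNReal.ofReal_coe_nnreal, ENNReal.ofReal_coe_nnreal]

end Energy

/-! ### Potential theory on finite networks -/

section Finite

variable {W : Type*} [Fintype W] (H : WeightedGraph W)

/-- The Laplacian without normalization. -/
def rawLaplacian (f : W → ℝ) (z : W) : ℝ := ∑ w, (H.weight z w : ℝ) * (f z - f w)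

/-- The bilinear energy form of a finite graph. -/
noncomputable def energyForm (f g : W → ℝ) : ℝ :=
  2⁻¹ * ∑ z, ∑ w, (H.weight z w : ℝ) * ((f z - f w) * (g z - g w))

/-- Green's formula: exchanging the two endpoints of each edge symmetrizes the double sum. -/
lemma sum_mul_rawLaplacian (f g : W → ℝ) :
    ∑ z, g z * H.rawLaplacian f z = H.energyForm f g := by
  have h1 : ∑ z, g z * H.rawLaplacian f z =
      ∑ z, ∑ w, (H.weight z w : ℝ) * ((f z - f w) * g z) :=
    Finset.sum_congr rfl fun z _ => by
      rw [rawLaplacian, Finset.mul_sum]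
      exact Finset.sum_congr rfl fun w _ => by ring
  have h2 : ∑ z, ∑ w, (H.weight z w : ℝ) * ((f z - f w) * g z) =
      ∑ z, ∑ w, (H.weight z w : ℝ) * ((f z - f w) * (-g w)) := by
    rw [Finset.sum_comm]
    exact Finset.sum_congr rfl fun z _ => Finset.sum_congr rfl fun w _ => by
      rw [H.weight_symm]; ring
  have h3 : 2 * H.energyForm f g = ∑ z, ∑ w, (H.weight z w : ℝ) * ((f z - f w) * g z) +
      ∑ z, ∑ w, (H.weight z w : ℝ) * ((f z - f w) * (-g w)) := by
    rw [energyForm, mul_inv_cancel_left₀ two_ne_zero]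
    simp only [← Finset.sum_add_distrib]
    exact Finset.sum_congr rfl fun z _ => Finset.sum_congr rfl fun w _ => by ring
  linarith

lemma energyForm_comm (f g : W → ℝ) : H.energyForm f g = H.energyForm g f := by
  unfold energyForm
  simp only [mul_comm (f _ - f _)]

lemma energyForm_self_nonneg (f : W → ℝ) : 0 ≤ H.energyForm f f :=
  mul_nonneg (by norm_num) (Finset.sum_nonneg fun _ _ => Finset.sum_nonneg fun _ _ =>
    mul_nonneg (NNReal.coe_nonneg _) (mul_self_nonneg _))

variable {H} in
lemma Connected.eq_of_energyForm_self_nonpos (hH : H.Connected) {f : W → ℝ}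
    (hf : H.energyForm f f ≤ 0) (x y : W) : f x = f y := by
  have h0 : ∀ z w, 0 ≤ (H.weight z w : ℝ) * ((f z - f w) * (f z - f w)) := fun z w =>
    mul_nonneg (NNReal.coe_nonneg _) (mul_self_nonneg _)
  have h1 : ∑ z, ∑ w, (H.weight z w : ℝ) * ((f z - f w) * (f z - f w)) = 0 := by
    refine le_antisymm ?_ (Finset.sum_nonneg fun _ _ => Finset.sum_nonneg fun _ _ => h0 _ _)
    unfold energyForm at hf
    linarith
  have hadj : ∀ z w, H.Adj z w → f z = f w := by
    intro z w hzw
    have h2 := (Finset.sum_eq_zero_iff_of_nonneg fun z _ =>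
      Finset.sum_nonneg fun w _ => h0 z w).1 h1 z (Finset.mem_univ z)
    have h3 := (Finset.sum_eq_zero_iff_of_nonneg fun w _ => h0 z w).1 h2 w (Finset.mem_univ w)
    have h4 : (H.weight z w : ℝ) ≠ 0 := NNReal.coe_ne_zero.2 (ne_of_gt hzw)
    have := (mul_eq_zero.1 h3).resolve_left h4
    exact sub_eq_zero.1 (mul_self_eq_zero.1 this)
  induction hH x y with
  | refl => rfl
  | tail _ h ih => exact ih.trans (hadj _ _ h)

variable {H} in
lemma Connected.eq_of_rawLaplacian_eq_zero (hH : H.Connected) {f : W → ℝ}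
    (hf : ∀ z, H.rawLaplacian f z = 0) (x y : W) : f x = f y := by
  refine hH.eq_of_energyForm_self_nonpos ?_ x y
  rw [← sum_mul_rawLaplacian]
  simp [hf]

lemma rawLaplacian_sub (f g : W → ℝ) (z : W) :
    H.rawLaplacian (fun w => f w - g w) z = H.rawLaplacian f z - H.rawLaplacian g z := by
  simp only [rawLaplacian, ← Finset.sum_sub_distrib]
  exact Finset.sum_congr rfl fun w _ => by ring

lemma rawLaplacian_sum {ι : Type*} (s : Finset ι) (a : ι → ℝ) (f : ι → W → ℝ) (z : W) :
    H.rawLaplacian (fun w => ∑ i ∈ s, a i * f i w) z = ∑ i ∈ s, a i * H.rawLaplacian (f i) z := by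
  simp only [rawLaplacian, Finset.mul_sum, ← Finset.sum_sub_distrib]
  rw [Finset.sum_comm]
  exact Finset.sum_congr rfl fun i _ => Finset.sum_congr rfl fun w _ => by ring

lemma vertexWeight_toReal (z : W) : (H.vertexWeight z).toReal = ∑ w, (H.weight z w : ℝ) := by
  rw [vertexWeight, tsum_fintype, ENNReal.toReal_sum fun _ _ => ENNReal.coe_ne_top]
  simp

lemma vertexWeight_mul_laplacian (f : W → ℝ) (z : W) :
    (H.vertexWeight z).toReal * H.laplacian f z = H.rawLaplacian f z := by
  have hz := H.vertexWeight_toReal z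
  have h0 : ∀ w, (H.vertexWeight z).toReal *
      ((H.weight z w : ℝ) / (H.vertexWeight z).toReal * f w) = (H.weight z w : ℝ) * f w := by
    intro w
    by_cases h : (H.vertexWeight z).toReal = 0
    · rw [hz] at h
      have := (Finset.sum_eq_zero_iff_of_nonneg fun w _ => NNReal.coe_nonneg (H.weight z w)).1 h w
        (Finset.mem_univ w)
      simp [this]
    · field_simp
  rw [laplacian, mul_sub, Finset.mul_sum]
  simp only [h0]
  rw [hz, rawLaplacian, Finset.sum_mul, ← Finset.sum_sub_distrib]
  exact Finset.sum_congr rfl fun w _ => by ring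

variable {H} in
lemma Connected.vertexWeight_toReal_ne_zero (hH : H.Connected) {x y : W} (hxy : x ≠ y) :
    (H.vertexWeight x).toReal ≠ 0 := by
  rw [vertexWeight_toReal]
  intro h
  obtain h' | ⟨w, hw, -⟩ := Relation.ReflTransGen.cases_head (hH x y)
  · exact hxy h'
  · have := (Finset.sum_eq_zero_iff_of_nonneg fun w _ => NNReal.coe_nonneg (H.weight x w)).1 h w
      (Finset.mem_univ w)
    exact (ne_of_gt hw) (NNReal.coe_eq_zero.1 this)

variable {H} in
open scoped Classical in
lemma IsDirichletSolution.rawLaplacian_eq (hH : H.Connected) {x y : W} {φ : W → ℝ}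
    (hφ : H.IsDirichletSolution x y φ) (z : W) :
    H.rawLaplacian φ z = (if z = x then 1 else 0) - (if z = y then 1 else 0) := by
  rw [← vertexWeight_mul_laplacian, hφ.1 z]
  by_cases hxy : x = y
  · subst hxy; simp
  · have hx := hH.vertexWeight_toReal_ne_zero hxy
    have hy := hH.vertexWeight_toReal_ne_zero (Ne.symm hxy)
    by_cases hzx : z = x
    · subst hzx
      simp [hxy, hx]
    · by_cases hzy : z = y
      · subst hzy
        simp [hzx, hy]
      · simp [hzx, hzy]

/-- The potential of a unit flow from `x` to `y`, expressed through the effective resistance. -/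
noncomputable def potential {V : Type*} (R : V → V → ℝ≥0) (x y z : V) : ℝ :=
  ((R x y : ℝ) + R z y - R x z) / 2

variable {H} {R : W → W → ℝ≥0}

lemma IsEffectiveResistance.self_eq_zero (hR : H.IsEffectiveResistance R) (x : W) : R x x = 0 := by
  obtain ⟨φ, hφ, h⟩ := hR x x
  rw [hφ.2] at h
  exact_mod_cast h

/-- Reciprocity `φ^{xy}(z) = φ^{zy}(x)` comes from the symmetry of the energy form. Superposition
says that `φ^{xy} - φ^{zy} - φ^{xz}` is constant. Comparing its values at `x` and `z` gives a linear
equation for `φ^{xy}(z)`. -/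
lemma IsEffectiveResistance.isDirichletSolution_eq (hR : H.IsEffectiveResistance R)
    (hH : H.Connected) {x y : W} {φ : W → ℝ} (hφ : H.IsDirichletSolution x y φ) :
    φ = potential R x y := by
  classical
  have main : ∀ {x y : W} {φ ψ : W → ℝ}, H.IsDirichletSolution x y φ →
      H.IsDirichletSolution x y ψ → φ = ψ := by
    intro x y φ ψ h1 h2
    funext z
    have := hH.eq_of_rawLaplacian_eq_zero (f := fun z => φ z - ψ z) (fun z => by
      rw [rawLaplacian_sub, h1.rawLaplacian_eq hH, h2.rawLaplacian_eq hH, sub_self]) z y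
    simp only [h1.2, h2.2] at this
    linarith
  funext z
  obtain ⟨φ', h1, hxy⟩ := hR x y
  rw [main hφ h1]
  obtain ⟨ψ, h2, hzy⟩ := hR z y
  obtain ⟨χ, h3, hxz⟩ := hR x z
  have hrec : φ' z = ψ x := by
    have e1 := H.sum_mul_rawLaplacian φ' ψ
    have e2 := H.sum_mul_rawLaplacian ψ φ'
    rw [energyForm_comm, ← e1] at e2
    simp only [h1.rawLaplacian_eq hH, h2.rawLaplacian_eq hH, mul_sub, Finset.sum_sub_distrib,
      mul_ite, mul_one, mul_zero, Finset.sum_ite_eq', Finset.mem_univ, if_true, h1.2, h2.2,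
      sub_zero] at e2
    exact e2
  have hdiff := hH.eq_of_rawLaplacian_eq_zero (f := fun w => φ' w - ψ w - χ w) (fun w => by
    rw [rawLaplacian_sub, rawLaplacian_sub, h1.rawLaplacian_eq hH, h2.rawLaplacian_eq hH,
      h3.rawLaplacian_eq hH]
    ring) x z
  simp only [h3.2] at hdiff
  rw [potential, hxy, hzy, hxz]
  linarith

open scoped Classical in
lemma IsEffectiveResistance.rawLaplacian_potential (hR : H.IsEffectiveResistance R)
    (hH : H.Connected) (x y z : W) :
    H.rawLaplacian (potential R x y) z = (if z = x then 1 else 0) - (if z = y then 1 else 0) := by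
  obtain ⟨φ, hφ, -⟩ := hR x y
  rw [← hR.isDirichletSolution_eq hH hφ, hφ.rawLaplacian_eq hH]

/-- The potential is the Riesz representer of `u ↦ u x - u y` for the energy form. -/
lemma IsEffectiveResistance.energyForm_potential (hR : H.IsEffectiveResistance R)
    (hH : H.Connected) (x y : W) (u : W → ℝ) :
    H.energyForm (potential R x y) u = u x - u y := by
  classical
  rw [← sum_mul_rawLaplacian]
  simp [hR.rawLaplacian_potential hH, mul_sub]

lemma potential_apply_left {V : Type*} (R : V → V → ℝ≥0) {x y : V} (h : R x x = 0) :
    potential R x y x = R x y := by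
  simp [potential, h]

lemma potential_apply_right {V : Type*} (R : V → V → ℝ≥0) {x y : V} (h : R y y = 0) :
    potential R x y y = 0 := by
  simp [potential, h]

lemma IsEffectiveResistance.energyForm_potential_self (hR : H.IsEffectiveResistance R)
    (hH : H.Connected) (x y : W) :
    H.energyForm (potential R x y) (potential R x y) = R x y := by
  rw [hR.energyForm_potential hH, potential_apply_left R (hR.self_eq_zero x),
    potential_apply_right R (hR.self_eq_zero y), sub_zero]

lemma IsEffectiveResistance.pos (hR : H.IsEffectiveResistance R) (hH : H.Connected) {x y : W}
    (hxy : x ≠ y) : 0 < R x y := by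
  classical
  rw [pos_iff_ne_zero]
  intro h
  have h0 := hH.eq_of_energyForm_self_nonpos (f := potential R x y)
    (by rw [hR.energyForm_potential_self hH, h]; simp)
  have h1 := hR.rawLaplacian_potential hH x y x
  rw [rawLaplacian, Finset.sum_eq_zero fun w _ => by rw [h0 x w]; ring] at h1
  simp [hxy] at h1

/-- With `r = R x y` and `φ` the potential, `0 ≤ E(u - φ/r) = E(u) - 2/r + 1/r`. -/
lemma IsEffectiveResistance.inv_le_energyForm (hR : H.IsEffectiveResistance R)
    (hH : H.Connected) {x y : W} (hxy : x ≠ y) {u : W → ℝ} (hx : u x = 1) (hy : u y = 0) :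
    (R x y : ℝ)⁻¹ ≤ H.energyForm u u := by
  have hpos : (0 : ℝ) < R x y := NNReal.coe_pos.2 (hR.pos hH hxy)
  set φ := potential R x y
  set r := (R x y : ℝ)
  have h1 : H.energyForm φ u = 1 := by rw [hR.energyForm_potential hH, hx, hy, sub_zero]
  have h2 : H.energyForm φ φ = r := hR.energyForm_potential_self hH x y
  have h3 := H.energyForm_self_nonneg fun z => u z - r⁻¹ * φ z
  have h4 : H.energyForm (fun z => u z - r⁻¹ * φ z) (fun z => u z - r⁻¹ * φ z) =
      H.energyForm u u - 2 * r⁻¹ * H.energyForm φ u + r⁻¹ ^ 2 * H.energyForm φ φ := by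
    simp only [energyForm, Finset.mul_sum, ← Finset.sum_sub_distrib, ← Finset.sum_add_distrib]
    exact Finset.sum_congr rfl fun z _ => Finset.sum_congr rfl fun w _ => by ring
  rw [h4, h1, h2] at h3
  have h5 : r⁻¹ ^ 2 * r = r⁻¹ := by field_simp
  linarith

end Finite

/-! ### Monotonicity and convergence of the edge weights -/

section Extend

variable {V : Type*} {s t : Finset V}

lemma extend_weight_coe (G : WeightedGraph s) (x y : s) : G.extend.weight x y = G.weight x y := by
  simp [extend]

lemma extend_weight_of_notMem (G : WeightedGraph s) {x y : V} (h : ¬(x ∈ s ∧ y ∈ s)) :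
    G.extend.weight x y = 0 := by
  simp [extend, h]

lemma extend_energy (G : WeightedGraph s) (u : V → ℝ) :
    G.extend.energy u = ENNReal.ofReal (G.energyForm (fun z => u z) (fun z => u z)) := by
  have key : ∀ F : V → ℝ≥0∞, (∀ x ∉ s, F x = 0) → ∑' x, F x = ∑ x : s, F x := fun F hF => by
    rw [tsum_eq_sum fun x hx => hF x hx, ← Finset.sum_coe_sort]
  have h0 : ∀ x y, ¬(x ∈ s ∧ y ∈ s) →
      (G.extend.weight x y : ℝ≥0∞) * ENNReal.ofReal ((u x - u y) ^ 2) = 0 := fun x y h => by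
    simp [extend_weight_of_notMem G h]
  have h1 : ∀ z w : s, 0 ≤ (G.weight z w : ℝ) * ((u z - u w) * (u z - u w)) := fun z w =>
    mul_nonneg (NNReal.coe_nonneg _) (mul_self_nonneg _)
  rw [energy, key _ fun x hx => ENNReal.tsum_eq_zero.2 fun y => h0 x y fun h => hx h.1, energyForm,
    ENNReal.ofReal_mul (by norm_num), ENNReal.ofReal_inv_of_pos (by norm_num),
    ENNReal.ofReal_sum_of_nonneg fun z _ => Finset.sum_nonneg fun w _ => h1 z w]
  congr 1
  · simp
  · refine Finset.sum_congr rfl fun z _ => ?_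
    rw [key _ fun y hy => h0 z y fun h => hy h.2,
      ENNReal.ofReal_sum_of_nonneg fun w _ => h1 z w]
    refine Finset.sum_congr rfl fun w _ => ?_
    rw [extend_weight_coe, ENNReal.ofReal_mul (NNReal.coe_nonneg _), ENNReal.ofReal_coe_nnreal, sq]

/-- If two finite networks have the same effective resistance on the smaller vertex set, the larger
one has the smaller edge weights. -/
lemma extend_weight_le_of_subset (hst : s ⊆ t) {R : V → V → ℝ≥0} {G : WeightedGraph s}
    {H : WeightedGraph t} (hG : G.Connected) (hH : H.Connected)
    (hGR : G.IsEffectiveResistance fun x y => R x y)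
    (hHR : H.IsEffectiveResistance fun x y => R x y) {q p : V} (hq : q ∈ s) (hp : p ∈ s) :
    H.extend.weight q p ≤ G.extend.weight q p := by
  classical
  by_cases hqp : q = p
  · subst hqp
    rw [weight_self, weight_self]
  let ι : s → t := fun z => ⟨z, hst z.2⟩
  let a : s → ℝ := G.rawLaplacian fun z => if (z : V) = p then 1 else 0
  have ha : ∑ z, a z = 0 := by
    have := G.sum_mul_rawLaplacian (fun z => if (z : V) = p then 1 else 0) fun _ => 1
    simpa [energyForm, a] using this
  -- Superposition of potentials with sources `a = Δ_G 1_p`. As it depends on `R` alone, it can be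
  -- read in both networks: on `s` it is `1_p` up to a constant, and on `t` its Laplacian is `a` on
  -- `s` and zero elsewhere. So `h` below is the `H`-harmonic extension of `1_p`.
  let U : V → ℝ := fun w => ∑ x : s, a x * potential R x p w
  have hGU : ∀ z : s, G.rawLaplacian (fun z => U z) z = a z := by
    intro z
    have h1 : G.rawLaplacian (fun z => U z) z =
        ∑ x : s, a x * G.rawLaplacian (potential (fun x y : s => R x y) x ⟨p, hp⟩) z :=
      G.rawLaplacian_sum Finset.univ a
        (fun x => potential (fun x y : s => R x y) x ⟨p, hp⟩) z
    rw [h1]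
    simp only [hGR.rawLaplacian_potential hG, mul_sub, Finset.sum_sub_distrib, ← Finset.sum_mul, ha]
    simp
  have hHU : ∀ z : t, H.rawLaplacian (fun z => U z) z = ∑ x : s, if z = ι x then a x else 0 := by
    intro z
    have h1 : H.rawLaplacian (fun z => U z) z =
        ∑ x : s, a x * H.rawLaplacian (potential (fun x y : t => R x y) (ι x) (ι ⟨p, hp⟩)) z :=
      H.rawLaplacian_sum Finset.univ a
        (fun x => potential (fun x y : t => R x y) (ι x) (ι ⟨p, hp⟩)) z
    rw [h1]
    simp only [hHR.rawLaplacian_potential hH, mul_sub, Finset.sum_sub_distrib, ← Finset.sum_mul, ha]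
    simp
  let h : V → ℝ := fun w => U w - (U p - 1)
  have hs : ∀ z ∈ s, h z = if z = p then 1 else 0 := by
    intro z hz
    have := hG.eq_of_rawLaplacian_eq_zero (f := fun z => U z - if (z : V) = p then 1 else 0)
      (fun z => by rw [rawLaplacian_sub, hGU]; exact sub_self _) ⟨z, hz⟩ ⟨p, hp⟩
    simp only [if_true] at this
    simp only [h]
    linarith
  have hHh : ∀ z : t, H.rawLaplacian (fun z => h z) z = ∑ x : s, if z = ι x then a x else 0 := by
    intro z
    rw [← hHU]
    exact Finset.sum_congr rfl fun w _ => by simp only [h]; ring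
  -- Minimum principle: the negative part `m` vanishes on `s` and `h` is harmonic off `s`, so
  -- `E(m,m) ≤ -E(h,m) = 0` and `m` is constant, hence zero.
  have hpos : ∀ z : t, 0 ≤ h z := by
    let m : t → ℝ := fun z => max (-h z) 0
    have hms : ∀ z : t, (z : V) ∈ s → m z = 0 := by
      intro z hz
      simp only [m, hs z hz]
      split_ifs <;> simp
    have h0 : H.energyForm (fun z => h z) m = 0 := by
      rw [← sum_mul_rawLaplacian]
      refine Finset.sum_eq_zero fun z _ => ?_
      by_cases hz : (z : V) ∈ s
      · rw [hms z hz, zero_mul]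
      · rw [hHh, Finset.sum_eq_zero fun x _ => if_neg ?_, mul_zero]
        rintro rfl
        exact hz x.2
    have h1 : H.energyForm m m ≤ -H.energyForm (fun z => h z) m := by
      unfold energyForm
      rw [← mul_neg, ← Finset.sum_neg_distrib]
      refine mul_le_mul_of_nonneg_left (Finset.sum_le_sum fun z _ => ?_) (by norm_num)
      rw [← Finset.sum_neg_distrib]
      refine Finset.sum_le_sum fun w _ => ?_
      rw [← mul_neg]
      refine mul_le_mul_of_nonneg_left ?_ (NNReal.coe_nonneg _)
      simp only [m]
      rcases le_total (-h z) 0 with hz | hz <;> rcases le_total (-h w) 0 with hw | hw <;>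
        simp only [max_eq_left, max_eq_right, hz, hw] <;> nlinarith
    intro z
    have h2 := hH.eq_of_energyForm_self_nonpos (f := m) (by rw [h0] at h1; linarith) z (ι ⟨p, hp⟩)
    rw [hms (ι ⟨p, hp⟩) hp] at h2
    have h3 : -h z ≤ m z := le_max_left _ _
    linarith
  have e1 : a ⟨q, hq⟩ = -(G.weight ⟨q, hq⟩ ⟨p, hp⟩ : ℝ) := by
    simp only [a, rawLaplacian, hqp, if_false, zero_sub, mul_neg, mul_ite, mul_one, mul_zero]
    rw [Finset.sum_eq_single ⟨p, hp⟩]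
    · simp
    · intro w _ hw
      have : (w : V) ≠ p := fun h => hw (Subtype.ext h)
      simp [this]
    · simp
  have e2 : H.rawLaplacian (fun z => h z) (ι ⟨q, hq⟩) = a ⟨q, hq⟩ := by
    rw [hHh, Finset.sum_eq_single ⟨q, hq⟩]
    · simp
    · intro x _ hx
      refine if_neg fun h => hx ?_
      exact Subtype.ext (congrArg (fun z : t => (z : V)) h).symm
    · simp
  -- Since `h q = 0`, the Laplacian at `q` is minus a sum of nonnegative terms `c(q,w) h(w)`; only
  -- `w = p` is kept.
  have e3 : H.rawLaplacian (fun z => h z) (ι ⟨q, hq⟩) ≤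
      -(H.weight (ι ⟨q, hq⟩) (ι ⟨p, hp⟩) : ℝ) := by
    have hq0 : h q = 0 := by rw [hs q hq, if_neg hqp]
    have hp1 : h p = 1 := by rw [hs p hp, if_pos rfl]
    simp only [rawLaplacian, ι, hq0, zero_sub, mul_neg, Finset.sum_neg_distrib, neg_le_neg_iff]
    have := Finset.single_le_sum (f := fun w : t => (H.weight ⟨q, hst hq⟩ w : ℝ) * h w)
      (fun w _ => mul_nonneg (NNReal.coe_nonneg _) (hpos w)) (Finset.mem_univ ⟨p, hst hp⟩)
    simpa [hp1] using this
  have e4 := H.extend_weight_coe (ι ⟨q, hq⟩) (ι ⟨p, hp⟩)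
  have e5 := G.extend_weight_coe ⟨q, hq⟩ ⟨p, hp⟩
  simp only [ι] at e4 e5
  rw [e4, e5, ← NNReal.coe_le_coe]
  linarith

lemma tendsto_limitGraph_weight {Vn : ℕ → Finset V} (hVn : IsFiniteExhaustion Vn)
    {R : V → V → ℝ≥0} {G : ∀ n, WeightedGraph (Vn n)} (hconn : ∀ n, (G n).Connected)
    (hG : ∀ n, (G n).IsEffectiveResistance fun x y => R x y) (x y : V) :
    Tendsto (fun n => (G n).extend.weight x y) atTop
      (𝓝 ((limitGraph fun n => (G n).extend).weight x y)) := by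
  have hmono : Monotone Vn := monotone_nat_of_le_succ hVn.mono
  obtain ⟨i, hi⟩ := hVn.exhausts x
  obtain ⟨j, hj⟩ := hVn.exhausts y
  -- The shift by `max i j` is needed: before both points have entered `Vn`, the extended weight is
  -- `0`, which would break monotonicity.
  have hanti : Antitone fun m => (G (m + max i j)).extend.weight x y := by
    refine antitone_nat_of_succ_le fun m => ?_
    rw [show m + 1 + max i j = m + max i j + 1 by omega]
    exact extend_weight_le_of_subset (hVn.mono _) (hconn _) (hconn _) (hG _) (hG _)
      (hmono (by omega) hi) (hmono (by omega) hj)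
  have h1 := (tendsto_add_atTop_iff_nat (f := fun n => (G n).extend.weight x y) (max i j)).1
    (tendsto_atTop_ciInf hanti (OrderBot.bddBelow _))
  change Tendsto _ _ (𝓝 (limUnder atTop _))
  rwa [h1.limUnder_eq]

end Extend

/-! ### Passing to the limit in the energy -/

section EnergyLimit

variable {V : Type*} {H : ℕ → WeightedGraph V} {G : WeightedGraph V}

/-- Fatou's lemma: each finite partial sum of the energy converges. -/
lemma energy_le_of_tendsto (hw : ∀ x y, Tendsto (fun n => (H n).weight x y) atTop
    (𝓝 (G.weight x y))) {u : V → ℝ} {b : ℝ≥0∞} (hb : ∀ᶠ n in atTop, (H n).energy u ≤ b) :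
    G.energy u ≤ b := by
  have henergy : ∀ G : WeightedGraph V, G.energy u = 2⁻¹ * ∑' p : V × V,
      (G.weight p.1 p.2 : ℝ≥0∞) * ENNReal.ofReal ((u p.1 - u p.2) ^ 2) := fun G => by
    rw [energy, ENNReal.tsum_prod (f := fun x y =>
      (G.weight x y : ℝ≥0∞) * ENNReal.ofReal ((u x - u y) ^ 2))]
  rw [henergy, ENNReal.tsum_eq_iSup_sum, ENNReal.mul_iSup]
  refine iSup_le fun S => ?_
  have hlim : Tendsto (fun n => 2⁻¹ * ∑ p ∈ S, ((H n).weight p.1 p.2 : ℝ≥0∞) *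
      ENNReal.ofReal ((u p.1 - u p.2) ^ 2)) atTop (𝓝 (2⁻¹ * ∑ p ∈ S,
      (G.weight p.1 p.2 : ℝ≥0∞) * ENNReal.ofReal ((u p.1 - u p.2) ^ 2))) :=
    ENNReal.Tendsto.const_mul (tendsto_finsetSum _ fun p _ => ENNReal.Tendsto.mul_const
      (ENNReal.tendsto_coe.2 (hw _ _)) (Or.inr ENNReal.ofReal_ne_top)) (Or.inr (by simp))
  refine le_of_tendsto hlim (hb.mono fun n hn => le_trans ?_ hn)
  rw [henergy]
  exact mul_le_mul_right (ENNReal.sum_le_tsum S) _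

/-- With `g = u - k` finitely supported, expanding the squares leaves finite sums in the vertex
weights and the edge weights. Convergence of the vertex weights excludes loss of mass along edges
escaping to infinity. -/
lemma le_energy_of_tendsto (hw : ∀ x y, Tendsto (fun n => (H n).weight x y) atTop
    (𝓝 (G.weight x y)))
    (hv : ∀ x, Tendsto (fun n => (H n).vertexWeight x) atTop (𝓝 (G.vertexWeight x)))
    {u : V → ℝ} (hu : u ∈ finFun V) {b : ℝ≥0∞} (hb : ∀ᶠ n in atTop, b ≤ (H n).energy u) :
    b ≤ G.energy u := by
  obtain ⟨k, W, hW, huk⟩ := hu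
  lift W to Finset V using hW
  let g : V → ℝ := fun z => u z - k
  have hg : ∀ z ∉ W, g z = 0 := fun z hz => sub_eq_zero.2 (huk z hz)
  have hug : ∀ z, u z = g z + k := fun z => (sub_add_cancel _ _).symm
  have h1 : ∀ (G : WeightedGraph V) (F : ℝ → ℝ), F 0 = 0 →
      ∑' z, ∑' w, (G.weight z w : ℝ≥0∞) * ENNReal.ofReal (F (g z * g w)) =
      ∑ z ∈ W, ∑ w ∈ W, (G.weight z w : ℝ≥0∞) * ENNReal.ofReal (F (g z * g w)) := by
    intro G F hF
    rw [tsum_eq_sum fun z hz => ENNReal.tsum_eq_zero.2 fun w => by simp [hg z hz, hF]]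
    exact Finset.sum_congr rfl fun z _ => tsum_eq_sum fun w hw => by simp [hg w hw, hF]
  have h2 : ∀ G : WeightedGraph V, ∑' z, G.vertexWeight z * ENNReal.ofReal (g z ^ 2) =
      ∑ z ∈ W, G.vertexWeight z * ENNReal.ofReal (g z ^ 2) := fun G =>
    tsum_eq_sum fun z hz => by simp [hg z hz]
  have h3 : ∀ F : ℝ → ℝ, Tendsto
      (fun n => ∑ z ∈ W, ∑ w ∈ W, ((H n).weight z w : ℝ≥0∞) * ENNReal.ofReal (F (g z * g w)))
      atTop (𝓝 (∑ z ∈ W, ∑ w ∈ W, (G.weight z w : ℝ≥0∞) * ENNReal.ofReal (F (g z * g w)))) :=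
    fun F => tendsto_finsetSum _ fun z _ => tendsto_finsetSum _ fun w _ =>
      ENNReal.Tendsto.mul_const (ENNReal.tendsto_coe.2 (hw _ _)) (Or.inr ENNReal.ofReal_ne_top)
  have h4 : Tendsto (fun n => ∑ z ∈ W, (H n).vertexWeight z * ENNReal.ofReal (g z ^ 2)) atTop
      (𝓝 (∑ z ∈ W, G.vertexWeight z * ENNReal.ofReal (g z ^ 2))) :=
    tendsto_finsetSum _ fun z _ => ENNReal.Tendsto.mul_const (hv z) (Or.inr ENNReal.ofReal_ne_top)
  have hexp : ∀ G : WeightedGraph V, G.energy u +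
      ∑ z ∈ W, ∑ w ∈ W, (G.weight z w : ℝ≥0∞) * ENNReal.ofReal (g z * g w) =
      ∑ z ∈ W, G.vertexWeight z * ENNReal.ofReal (g z ^ 2) +
        ∑ z ∈ W, ∑ w ∈ W, (G.weight z w : ℝ≥0∞) * ENNReal.ofReal (-(g z * g w)) := fun G => by
    have := G.energy_add_tsum hug
    rwa [h1 G (fun r => r) rfl, h1 G (fun r => -r) neg_zero, h2] at this
  have hfin : ∑ z ∈ W, ∑ w ∈ W, (G.weight z w : ℝ≥0∞) * ENNReal.ofReal (g z * g w) ≠ ⊤ :=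
    ENNReal.sum_ne_top.2 fun z _ => ENNReal.sum_ne_top.2 fun w _ =>
      ENNReal.mul_ne_top ENNReal.coe_ne_top ENNReal.ofReal_ne_top
  refine (ENNReal.add_le_add_iff_right hfin).1 ?_
  rw [hexp]
  refine le_of_tendsto_of_tendsto (tendsto_const_nhds.add (h3 fun r => r)) (h4.add (h3 fun r => -r))
    (hb.mono fun n hn => ?_)
  dsimp only
  rw [← hexp]
  exact add_le_add hn le_rfl

end EnergyLimit

/-! ### The transition operator -/

section Step

variable {V : Type*} (G : WeightedGraph V)

/-- The transition operator of the random walk, on nonnegative functions. -/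
noncomputable def transition (g : V → ℝ≥0∞) (z : V) : ℝ≥0∞ := ∑' w, G.step z w * g w

lemma vertexWeight_mul_step {z : V} (hz : G.vertexWeight z ≠ ⊤) (w : V) :
    G.vertexWeight z * G.step z w = G.weight z w := by
  unfold step
  split_ifs with h
  · rw [PMF.normalize_apply, mul_comm, mul_assoc]
    change _ * ((G.vertexWeight z)⁻¹ * G.vertexWeight z) = _
    rw [ENNReal.inv_mul_cancel (a := G.vertexWeight z) h.1 h.2, mul_one]
  -- Only `c_z = 0` is left; the convention that the walk then stays put is harmless, as both sides
  -- vanish.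
  · have h0 : G.vertexWeight z = 0 := by
      by_contra h0
      exact h ⟨h0, hz⟩
    rw [h0, zero_mul]
    exact (ENNReal.tsum_eq_zero.1 h0 w).symm

lemma vertexWeight_mul_transition {z : V} (hz : G.vertexWeight z ≠ ⊤) (g : V → ℝ≥0∞) :
    G.vertexWeight z * G.transition g z = ∑' w, G.weight z w * g w := by
  rw [transition, ← ENNReal.tsum_mul_left]
  exact tsum_congr fun w => by rw [← mul_assoc, G.vertexWeight_mul_step hz]

lemma transition_mono {g h : V → ℝ≥0∞} (hgh : ∀ w, g w ≤ h w) (z : V) :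
    G.transition g z ≤ G.transition h z :=
  ENNReal.tsum_le_tsum fun w => mul_le_mul_right (hgh w) _

lemma transition_le_one {g : V → ℝ≥0∞} (hg : ∀ w, g w ≤ 1) (z : V) : G.transition g z ≤ 1 :=
  (G.transition_mono hg z).trans (by simp [transition, PMF.tsum_coe])

/-- Monotone convergence for the counting measure. -/
lemma transition_iSup {g : ℕ → V → ℝ≥0∞} (hg : ∀ w, Monotone fun k => g k w) (z : V) :
    G.transition (fun w => ⨆ k, g k w) z = ⨆ k, G.transition (g k) z := by
  let _ : MeasurableSpace V := ⊤
  simp only [transition, ENNReal.mul_iSup]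
  have h := lintegral_iSup (μ := Measure.count (α := V))
    (f := fun k w => G.step z w * g k w) (fun k => Measurable.of_discrete)
    fun i j hij w => mul_le_mul_right (hg w hij) _
  simpa only [lintegral_count' Measurable.of_discrete] using h

end Step

/-! ### Recurrence and cut-off functions of small energy -/

section Walk

variable {V : Type*} [Countable V] [MeasurableSpace V] [DiscreteMeasurableSpace V]
  (G : WeightedGraph V)

instance (x : V) : IsProbabilityMeasure (G.randomWalk x) := by
  unfold randomWalk; infer_instance

lemma lintegral_step (z : V) (g : V → ℝ≥0∞) :
    ∫⁻ w, g w ∂(G.stepKernel z) = G.transition g z := by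
  rw [lintegral_countable']
  refine tsum_congr fun w => ?_
  change g w * (G.step z).toMeasure {w} = _
  rw [PMF.toMeasure_apply_singleton _ _ (MeasurableSet.singleton w), mul_comm]

/-- The Markov property of the random walk at a fixed time. -/
lemma lintegral_randomWalk_succ (x : V) (i : ℕ) {F : (Finset.Iic i → V) → ℝ≥0∞}
    (hF : Measurable F) (g : V → ℝ≥0∞) :
    ∫⁻ ω, F (Preorder.frestrictLe i ω) * g (ω (i + 1)) ∂(G.randomWalk x) =
      ∫⁻ ω, F (Preorder.frestrictLe i ω) * G.transition g (ω i) ∂(G.randomWalk x) := by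
  have hg : Measurable g := Measurable.of_discrete
  have hm : Measurable fun p : (Finset.Iic i → V) × V => F p.1 * g p.2 := by fun_prop
  have h1 := Kernel.partialTraj_compProd_eq_map_traj (X := fun _ => V) (κ := G.historyKernel)
    (Nat.zero_le i) (x₀ := fun _ => x)
  have h2 := Kernel.traj_map_frestrictLe_apply (X := fun _ => V) (κ := G.historyKernel) 0 i
    (fun _ => x)
  have h3 : ∫⁻ ω, F (Preorder.frestrictLe i ω) * g (ω (i + 1)) ∂(G.randomWalk x) =
      ∫⁻ p, F p.1 * g p.2 ∂((G.randomWalk x).map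
        fun ω => (Preorder.frestrictLe (π := fun _ => V) i ω, ω (i + 1))) := by
    rw [lintegral_map hm (by fun_prop)]
  rw [h3, randomWalk, ← h1, Measure.lintegral_compProd hm, ← h2, lintegral_map _ (by fun_prop)]
  · refine lintegral_congr fun ω => ?_
    dsimp only
    rw [lintegral_const_mul _ hg]
    congr 1
    exact G.lintegral_step _ _
  · exact Measurable.lintegral_kernel_prod_right' hm

/-- If the walk started at `x` returns almost surely, then a function that dominates `1` at `x` and
is superharmonic off `x` satisfies `1 ≤ (P s)(x)`. -/
lemma one_le_transition_of_superharmonic (x : V)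
    (hrec : ∀ᵐ ω ∂(G.randomWalk x), ∃ k, 1 ≤ k ∧ ω k = x) {s : V → ℝ≥0∞} (hx : 1 ≤ s x)
    (hs : ∀ z ≠ x, G.transition s z ≤ s z) : 1 ≤ G.transition s x := by
  classical
  set P := G.randomWalk x
  -- `A i` is the event of no return to `x` during times `1, …, i`; `B i` expresses it through the
  -- history up to time `i`, as the Markov property requires.
  let A : ℕ → Set (ℕ → V) := fun i => {ω | ∀ j, 1 ≤ j → j ≤ i → ω j ≠ x}
  have hA : ∀ i, MeasurableSet (A i) := fun i => by
    have : A i = ⋂ j, ⋂ (_ : 1 ≤ j), ⋂ (_ : j ≤ i), (fun ω : ℕ → V => ω j) ⁻¹' {x}ᶜ := by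
      ext ω; simp [A]
    rw [this]
    exact MeasurableSet.iInter fun j => MeasurableSet.iInter fun _ => MeasurableSet.iInter fun _ =>
      measurable_pi_apply j (MeasurableSet.of_discrete)
  let B : ∀ i, Set (Finset.Iic i → V) := fun i => {h | ∀ j : Finset.Iic i, 1 ≤ j.1 → h j ≠ x}
  have hB : ∀ i, MeasurableSet (B i) := fun i => by
    have : B i = ⋂ j : Finset.Iic i, ⋂ (_ : 1 ≤ j.1), (fun h => h j) ⁻¹' {x}ᶜ := by
      ext ω; simp [B]
    rw [this]
    exact MeasurableSet.iInter fun j => MeasurableSet.iInter fun _ =>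
      measurable_pi_apply j (MeasurableSet.of_discrete)
  have hAB : ∀ i ω, (A i).indicator (1 : (ℕ → V) → ℝ≥0∞) ω =
      (B i).indicator 1 (Preorder.frestrictLe (π := fun _ => V) i ω) := fun i ω => by
    have : ω ∈ A i ↔ Preorder.frestrictLe (π := fun _ => V) i ω ∈ B i := by
      simp only [A, B, Set.mem_ofPred_eq, Subtype.forall, Finset.mem_Iic]
      exact ⟨fun h j hj h1 => h j h1 hj, fun h j h1 hj => h j hj h1⟩
    simp only [Set.indicator_apply, this, Pi.one_apply]
  have hmarkov : ∀ i, ∫⁻ ω, (A i).indicator 1 ω * s (ω (i + 1)) ∂P =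
      ∫⁻ ω, (A i).indicator 1 ω * G.transition s (ω i) ∂P := fun i => by
    simp only [hAB]
    exact G.lintegral_randomWalk_succ x i (measurable_one.indicator (hB i)) s
  have hsucc : ∀ i ω, (A (i + 1))ᶜ.indicator (1 : (ℕ → V) → ℝ≥0∞) ω +
      (A (i + 1)).indicator 1 ω * s (ω (i + 1)) ≤
      (A i)ᶜ.indicator 1 ω + (A i).indicator 1 ω * s (ω (i + 1)) := fun i ω => by
    have hiff : ω ∈ A (i + 1) ↔ ω ∈ A i ∧ ω (i + 1) ≠ x := by
      constructor
      · exact fun h => ⟨fun j h1 hj => h j h1 (by omega), h _ (by omega) le_rfl⟩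
      · rintro ⟨h, h'⟩ j h1 hj
        rcases Nat.lt_or_ge i j with hij | hij
        · obtain rfl : j = i + 1 := by omega
          exact h'
        · exact h j h1 hij
    by_cases h1 : ω ∈ A i
    · by_cases h2 : ω (i + 1) = x
      · have h3 : ω ∉ A (i + 1) := fun h => (hiff.1 h).2 h2
        simpa [h1, h2, h3] using hx
      · have h3 : ω ∈ A (i + 1) := hiff.2 ⟨h1, h2⟩
        simp [h1, h3]
    · have h3 : ω ∉ A (i + 1) := fun h => h1 (hiff.1 h).1
      simp [h1, h3]
  have hind : ∀ i, Measurable ((A i)ᶜ.indicator (1 : (ℕ → V) → ℝ≥0∞)) := fun i =>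
    measurable_one.indicator (hA i).compl
  -- Supermartingale argument for the walk stopped on its return: paths that have returned count
  -- `1`, which is at most `s x`, and the others count the current value of `s`.
  have key : ∀ i, ∫⁻ ω, (A (i + 1))ᶜ.indicator 1 ω + (A (i + 1)).indicator 1 ω * s (ω (i + 1)) ∂P
      ≤ G.transition s x := by
    intro i
    induction i with
    | zero =>
      refine (lintegral_mono (hsucc 0)).trans ?_
      have h0 : A 0 = Set.univ := by
        ext ω
        simp only [A, Set.mem_ofPred_eq, Set.mem_univ, iff_true]
        intro j h1 h2
        omega
      rw [lintegral_add_left (hind 0), hmarkov, h0]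
      simp only [Set.compl_univ, Set.indicator_empty, Set.indicator_univ, Pi.one_apply, one_mul,
        lintegral_zero, zero_add]
      have hm : Measurable fun h : Finset.Iic 0 → V =>
          G.transition s (h ⟨0, Finset.mem_Iic.2 le_rfl⟩) :=
        (Measurable.of_discrete (f := G.transition s)).comp (measurable_pi_apply _)
      have h2 := Kernel.traj_map_frestrictLe_apply (X := fun _ => V) (κ := G.historyKernel) 0 0
        (fun _ => x)
      have h3 := lintegral_map (μ := P) hm (Preorder.measurable_frestrictLe (X := fun _ => V) 0)
      change ∫⁻ ω, G.transition s (Preorder.frestrictLe (π := fun _ => V) 0 ω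
        ⟨0, Finset.mem_Iic.2 le_rfl⟩) ∂P ≤ _
      rw [← h3]
      simp only [P, randomWalk]
      rw [h2, Kernel.partialTraj_self, Kernel.id_apply, lintegral_dirac' _ hm]
    | succ i ih =>
      refine (lintegral_mono (hsucc (i + 1))).trans (le_trans ?_ ih)
      rw [lintegral_add_left (hind _), lintegral_add_left (hind _), hmarkov]
      refine add_le_add le_rfl (lintegral_mono fun ω => ?_)
      by_cases h : ω ∈ A (i + 1)
      · simpa [h] using hs _ (h (i + 1) (by omega) le_rfl)
      · simp [h]
  have hmono : Monotone fun i => (A (i + 1))ᶜ := fun i j hij ω h h' =>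
    h fun l h1 h2 => h' l h1 (by omega)
  have hunion : P (⋃ i, (A (i + 1))ᶜ) = 1 := by
    refine (prob_compl_eq_zero_iff (MeasurableSet.iUnion fun i => (hA _).compl)).1 ?_
    refine measure_mono_null ?_ (ae_iff.1 hrec)
    intro ω hω
    simp only [Set.mem_compl_iff, Set.mem_iUnion, not_exists, not_not] at hω
    rintro ⟨k, h1, h2⟩
    exact hω k k h1 (by omega) h2
  -- Dropping the nonnegative term with `s` leaves the probability of a return by time `i + 1`,
  -- whose supremum is `1`.
  rw [← hunion, hmono.measure_iUnion]
  refine iSup_le fun i => le_trans ?_ (key i)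
  rw [← lintegral_indicator_one (hA _).compl]
  exact lintegral_mono fun ω => le_self_add

/-- A recurrent walk yields finitely supported functions of small energy with value `1` at the
starting point. -/
lemma exists_finite_support_tendsto_energy {Vn : ℕ → Finset V} (hVn : IsFiniteExhaustion Vn)
    (hfin : ∀ v, G.vertexWeight v < ⊤) (x : V)
    (hrec : ∀ᵐ ω ∂(G.randomWalk x), ∃ k, 1 ≤ k ∧ ω k = x) :
    ∃ f : ℕ → V → ℝ, (∀ k, f k x = 1) ∧ (∀ k z, 0 ≤ f k z) ∧ (∀ k z, f k z ≤ 1) ∧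
      (∀ k, ∃ W : Finset V, ∀ z ∉ W, f k z = 0) ∧
      Tendsto (fun k => G.energy (f k)) atTop (𝓝 0) := by
  classical
  have hVmono : Monotone Vn := monotone_nat_of_le_succ hVn.mono
  -- Iteration towards the probability of hitting `x`: keep the value `1` at `x`, apply the
  -- transition operator on `Vn k`, and put `0` elsewhere to keep the support finite.
  let f : ℕ → V → ℝ≥0∞ := fun k => Nat.rec (fun z => if z = x then 1 else 0)
    (fun k g z => if z = x then 1 else if z ∈ Vn k then G.transition g z else 0) k
  have hf0 : ∀ z, f 0 z = if z = x then 1 else 0 := fun z => rfl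
  have hfs : ∀ k z, f (k + 1) z =
      if z = x then 1 else if z ∈ Vn k then G.transition (f k) z else 0 := fun k z => rfl
  have hfx : ∀ k, f k x = 1 := fun k => by cases k <;> simp [hf0, hfs]
  have hle : ∀ k z, f k z ≤ 1 := by
    intro k
    induction k with
    | zero => intro z; rw [hf0]; split_ifs <;> simp
    | succ k ih =>
      intro z
      rw [hfs]
      split_ifs
      · exact le_rfl
      · exact G.transition_le_one ih z
      · exact zero_le
  have hstep : ∀ k z, f k z ≤ f (k + 1) z := by
    intro k
    induction k with
    | zero =>
      intro z
      by_cases hz : z = x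
      · rw [hz]
        exact (hfx 0).le.trans (hfx 1).ge
      · simp [hf0, hz]
    | succ k ih =>
      intro z
      rw [hfs k, hfs (k + 1)]
      split_ifs with h1 h2 h3 h3
      · exact le_rfl
      · exact G.transition_mono ih z
      · exact absurd (hVn.mono k h2) h3
      · exact zero_le
      · exact zero_le
  have hmono : ∀ z, Monotone fun k => f k z := fun z => monotone_nat_of_le_succ fun k => hstep k z
  have hsupp : ∀ k, ∃ W : Finset V, ∀ z ∉ W, f k z = 0 := by
    intro k
    cases k with
    | zero => exact ⟨{x}, fun z hz => by rw [hf0, if_neg (by simpa using hz)]⟩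
    | succ k =>
      refine ⟨insert x (Vn k), fun z hz => ?_⟩
      rw [Finset.mem_insert, not_or] at hz
      rw [hfs, if_neg hz.1, if_neg hz.2]
  have hsub : ∀ k z, z ≠ x → f k z ≤ G.transition (f k) z := by
    intro k z hz
    by_cases hk : z ∈ Vn k
    · have := hstep k z
      rwa [hfs, if_neg hz, if_pos hk] at this
    · cases k with
      | zero => simp [hf0, hz]
      | succ k =>
        rw [hfs, if_neg hz, if_neg fun h => hk (hVn.mono k h)]
        exact zero_le
  -- The supremum of the `f k` is superharmonic off `x` with value `1` at `x`, so recurrence applies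
  -- to it.
  have hone : ⨆ k, G.transition (f k) x = 1 := by
    refine le_antisymm (iSup_le fun k => G.transition_le_one (hle k) x) ?_
    rw [← G.transition_iSup hmono]
    refine G.one_le_transition_of_superharmonic x hrec ?_ fun z hz => ?_
    · exact (hfx 0).symm.le.trans (le_iSup (fun k => f k x) 0)
    · rw [G.transition_iSup hmono]
      refine iSup_le fun k => ?_
      obtain ⟨n, hn⟩ := hVn.exhausts z
      have hmem : z ∈ Vn (max k n) := hVmono (le_max_right _ _) hn
      refine le_trans ?_ (le_iSup (fun k => f k z) (max k n + 1))
      rw [hfs, if_neg hz, if_pos hmem]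
      exact G.transition_mono (fun w => hmono w (le_max_left _ _)) z
  -- By summation by parts `E(f) = ∑ c_z f(z) (f(z) - Pf(z))`. Terms off `x` are nonpositive by
  -- `hsub`, and the term at `x` is `c_x (1 - Pf(x))`. The identity is used in additive form, with a
  -- finite sum to cancel.
  have henergy : ∀ k, G.energy (fun z => (f k z).toReal) ≤
      G.vertexWeight x * (1 - G.transition (f k) x) := by
    intro k
    have hF : ∀ z, ENNReal.ofReal (f k z).toReal = f k z := fun z =>
      ENNReal.ofReal_toReal ((hle k z).trans_lt ENNReal.one_lt_top).ne
    have h1 := G.energy_add_tsum (u := fun z => (f k z).toReal) (g := fun z => (f k z).toReal)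
      (k := 0) fun z => (add_zero _).symm
    have h2 : ∀ z w, ENNReal.ofReal (-((f k z).toReal * (f k w).toReal)) = 0 := fun z w =>
      ENNReal.ofReal_of_nonpos (neg_nonpos.2 (mul_nonneg ENNReal.toReal_nonneg
        ENNReal.toReal_nonneg))
    have h3 : ∀ z, ∑' w, (G.weight z w : ℝ≥0∞) * (f k z * f k w) =
        f k z * (G.vertexWeight z * G.transition (f k) z) := fun z => by
      rw [G.vertexWeight_mul_transition (hfin z).ne, ← ENNReal.tsum_mul_left]
      exact tsum_congr fun w => mul_left_comm _ _ _
    simp only [ENNReal.ofReal_mul ENNReal.toReal_nonneg, hF, sq, h2, mul_zero, tsum_zero, add_zero,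
      h3] at h1
    have hne : ∑' z, f k z * (G.vertexWeight z * G.transition (f k) z) ≠ ⊤ := by
      obtain ⟨W, hW⟩ := hsupp k
      rw [tsum_eq_sum (s := W) fun z hz => by rw [hW z hz, zero_mul]]
      exact ENNReal.sum_ne_top.2 fun z _ => ENNReal.mul_ne_top
        ((hle k z).trans_lt ENNReal.one_lt_top).ne (ENNReal.mul_ne_top (hfin z).ne
          ((G.transition_le_one (hle k) z).trans_lt ENNReal.one_lt_top).ne)
    refine (ENNReal.add_le_add_iff_right hne).1 ?_
    rw [h1, ← tsum_ite_eq x (fun _ => G.vertexWeight x * (1 - G.transition (f k) x)),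
      ← ENNReal.tsum_add]
    refine ENNReal.tsum_le_tsum fun z => ?_
    by_cases hz : z = x
    · subst hz
      rw [if_pos rfl, hfx, one_mul, one_mul, mul_one, ← mul_add,
        tsub_add_cancel_of_le (G.transition_le_one (hle k) z), mul_one]
    · rw [if_neg hz, zero_add, mul_left_comm]
      exact mul_le_mul_right (mul_le_mul_right (hsub k z hz) _) _
  refine ⟨fun k z => (f k z).toReal, fun k => by simp [hfx], fun k z => ENNReal.toReal_nonneg,
    fun k z => ENNReal.toReal_mono ENNReal.one_ne_top (hle k z), fun k => ?_, ?_⟩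
  · obtain ⟨W, hW⟩ := hsupp k
    exact ⟨W, fun z hz => by simp [hW z hz]⟩
  · have hlim : Tendsto (fun k => G.transition (f k) x) atTop (𝓝 1) := by
      rw [← hone]
      exact tendsto_atTop_iSup fun i j hij => G.transition_mono (fun w => hmono w hij) x
    have h1 : Tendsto (fun k => G.vertexWeight x * (1 - G.transition (f k) x)) atTop
        (𝓝 (G.vertexWeight x * (1 - 1))) :=
      ENNReal.Tendsto.const_mul (ENNReal.Tendsto.sub tendsto_const_nhds hlim
        (Or.inl ENNReal.one_ne_top)) (Or.inr (hfin x).ne)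
    rw [tsub_self, mul_zero] at h1
    exact tendsto_of_tendsto_of_tendsto_of_le_of_le tendsto_const_nhds h1
      (fun k => zero_le) henergy

end Walk

/-! ### Comparison of the wired and free infima -/

variable {V : Type*} {G : WeightedGraph V}

/-- If `x` carries finitely supported functions of small energy, then cutting off does not increase
the infimum of the energy. -/
lemma sInf_energy_finFun_le {x y : V} {f : ℕ → V → ℝ} (hfx : ∀ k, f k x = 1)
    (hf0 : ∀ k z, 0 ≤ f k z) (hf1 : ∀ k z, f k z ≤ 1)
    (hfW : ∀ k, ∃ W : Finset V, ∀ z ∉ W, f k z = 0)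
    (hf : Tendsto (fun k => G.energy (f k)) atTop (𝓝 0)) {u : V → ℝ} (hu : G.energy u < ⊤)
    (hx : u x = 1) (hy : u y = 0) :
    sInf (G.energy '' {u | u ∈ finFun V ∧ u x = 1 ∧ u y = 0}) ≤ G.energy u := by
  set I := sInf (G.energy '' {u | u ∈ finFun V ∧ u x = 1 ∧ u y = 0})
  -- Truncation to `[0, 1]` makes both factors of `v * f k` bounded by `1`, as the product estimate
  -- needs.
  let v : V → ℝ := fun z => max 0 (min 1 (u z))
  have hv0 : ∀ z, 0 ≤ v z := fun z => le_max_left _ _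
  have hv1 : ∀ z, v z ≤ 1 := fun z => max_le zero_le_one (min_le_left _ _)
  have hvu : G.energy v ≤ G.energy u := by
    have := G.energy_le_mul_add_mul (u := v) (v := u) (w := u) (a := 1) (b := 0) fun z z' => by
      have h : |v z - v z'| ≤ |u z - u z'| := by
        simp only [v, max_comm (0 : ℝ), min_comm (1 : ℝ)]
        exact (abs_max_sub_max_le_abs _ _ _).trans (abs_min_sub_min_le_max _ _ _ _ |>.trans
          (by simp))
      simpa using sq_le_sq.2 h
    simpa using this
  -- Competitor `v * f k`, with `(A + B)² ≤ (1 + t) A² + (1 + t⁻¹) B²`. Letting `k → ∞` at fixed `t`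
  -- removes the second energy; then `t → 0`.
  have hIk : ∀ (t : ℝ≥0), 0 < t → ∀ k,
      I ≤ ((1 + t : ℝ≥0) : ℝ≥0∞) * G.energy v + ((1 + t⁻¹ : ℝ≥0) : ℝ≥0∞) * G.energy (f k) := by
    intro t ht k
    refine le_trans (sInf_le ⟨fun z => v z * f k z, ⟨?_, ?_, ?_⟩, rfl⟩)
      (G.energy_le_mul_add_mul fun z z' => ?_)
    · obtain ⟨W, hW⟩ := hfW k
      exact ⟨0, W, W.finite_toSet, fun z hz => by simp [hW z (by simpa using hz)]⟩
    · simp [v, hx, hfx]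
    · simp [v, hy]
    · set A := f k z * (v z - v z') with hA
      set B := v z' * (f k z - f k z') with hB
      have hAB : v z * f k z - v z' * f k z' = A + B := by rw [hA, hB]; ring
      have hA2 : A ^ 2 ≤ (v z - v z') ^ 2 := by
        rw [hA, mul_pow]
        exact mul_le_of_le_one_left (sq_nonneg _) (pow_le_one₀ (hf0 k z) (hf1 k z))
      have hB2 : B ^ 2 ≤ (f k z - f k z') ^ 2 := by
        rw [hB, mul_pow]
        exact mul_le_of_le_one_left (sq_nonneg _) (pow_le_one₀ (hv0 z') (hv1 z'))
      have ht' : (0 : ℝ) < t := NNReal.coe_pos.2 ht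
      have hsq : (1 + t) * A ^ 2 + (1 + (t : ℝ)⁻¹) * B ^ 2 - (A + B) ^ 2 =
          (t : ℝ)⁻¹ * (t * A - B) ^ 2 := by
        field_simp
        ring
      have hnn : 0 ≤ (t : ℝ)⁻¹ * (t * A - B) ^ 2 := by positivity
      have h1 := mul_le_mul_of_nonneg_left hA2 (by positivity : (0 : ℝ) ≤ 1 + t)
      have h2 := mul_le_mul_of_nonneg_left hB2 (by positivity : (0 : ℝ) ≤ 1 + (t : ℝ)⁻¹)
      rw [hAB]
      push_cast
      linarith
  have hIt : ∀ (t : ℝ≥0), 0 < t → I ≤ ((1 + t : ℝ≥0) : ℝ≥0∞) * G.energy v := by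
    intro t ht
    have h1 : Tendsto (fun k => ((1 + t : ℝ≥0) : ℝ≥0∞) * G.energy v +
        ((1 + t⁻¹ : ℝ≥0) : ℝ≥0∞) * G.energy (f k)) atTop
        (𝓝 (((1 + t : ℝ≥0) : ℝ≥0∞) * G.energy v + ((1 + t⁻¹ : ℝ≥0) : ℝ≥0∞) * 0)) :=
      tendsto_const_nhds.add (ENNReal.Tendsto.const_mul hf (Or.inr ENNReal.coe_ne_top))
    rw [mul_zero, add_zero] at h1
    exact ge_of_tendsto' h1 (hIk t ht)
  refine le_trans ?_ hvu
  have h1 : Tendsto (fun t : ℝ≥0 => ((1 + t : ℝ≥0) : ℝ≥0∞) * G.energy v) (𝓝[>] 0)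
      (𝓝 (((1 + 0 : ℝ≥0) : ℝ≥0∞) * G.energy v)) := by
    refine ENNReal.Tendsto.mul_const (ENNReal.tendsto_coe.2 ?_) (Or.inr (hvu.trans_lt hu).ne)
    exact (tendsto_const_nhds.add tendsto_id).mono_left nhdsWithin_le_nhds
  rw [add_zero, ENNReal.coe_one, one_mul] at h1
  exact ge_of_tendsto h1 (eventually_nhdsWithin_of_forall fun t ht => hIt t ht)

lemma resistanceOn_self (G : WeightedGraph V) (D : Set (V → ℝ)) (x : V) :
    G.resistanceOn D x x = 0 := by
  have : {u : V → ℝ | u ∈ D ∧ u x = 1 ∧ u x = 0} = ∅ := by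
    ext u
    simp only [Set.mem_ofPred_eq, Set.mem_empty_iff_false, iff_false]
    rintro ⟨-, h1, h0⟩
    rw [h1] at h0
    exact one_ne_zero h0
  rw [resistanceOn, this]
  simp

end WeightedGraph

/-! ### The chain of inequalities between `1/R` and the two infima -/

theorem mainTheorem8 {V : Type*} [Countable V] [Infinite V]
    [MeasurableSpace V] [DiscreteMeasurableSpace V]
    (R : V → V → ℝ≥0) (hR : IsResistanceMetric R)
    (Vn : ℕ → Finset V) (hVn : IsFiniteExhaustion Vn)
    (G : ∀ n, WeightedGraph (Vn n)) (hconn : ∀ n, (G n).Connected)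
    (hG : ∀ n, (G n).IsEffectiveResistance fun x y => R x y)
    (GR : WeightedGraph V) (hGR : GR = WeightedGraph.limitGraph fun n => (G n).extend)
    (hlim : ∀ v, Tendsto (fun n => (G n).extend.vertexWeight v) atTop (𝓝 (GR.vertexWeight v)))
    (hfin : ∀ v, GR.vertexWeight v < ⊤)
    (hrec : GR.IsRecurrent) (x y : V) :
    (R x y : ℝ≥0∞) = GR.freeResistance x y ∧ (R x y : ℝ≥0∞) = GR.wiredResistance x y := by
  have hmono : Monotone Vn := monotone_nat_of_le_succ hVn.mono
  have hev : ∀ z, ∀ᶠ n in atTop, z ∈ Vn n := fun z => by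
    obtain ⟨n, hn⟩ := hVn.exhausts z
    exact eventually_atTop.2 ⟨n, fun m hm => hmono hm hn⟩
  by_cases hxy : x = y
  · subst hxy
    obtain ⟨n, hn⟩ := hVn.exhausts x
    have h0 : R x x = 0 := (hG n).self_eq_zero ⟨x, hn⟩
    simp [WeightedGraph.freeResistance, WeightedGraph.wiredResistance,
      WeightedGraph.resistanceOn_self, h0]
  have hw : ∀ a b, Tendsto (fun n => (G n).extend.weight a b) atTop (𝓝 (GR.weight a b)) := by
    rw [hGR]
    exact WeightedGraph.tendsto_limitGraph_weight hVn hconn hG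
  have hpos : 0 < R x y := by
    obtain ⟨n, hx, hy⟩ := ((hev x).and (hev y)).exists
    exact (hG n).pos (hconn n) (x := ⟨x, hx⟩) (y := ⟨y, hy⟩) fun h => hxy (congrArg Subtype.val h)
  have hself : ∀ z, R z z = 0 := fun z => by
    obtain ⟨n, hn⟩ := hVn.exhausts z
    exact (hG n).self_eq_zero ⟨z, hn⟩
  have hRinv : ENNReal.ofReal (R x y : ℝ)⁻¹ = (R x y : ℝ≥0∞)⁻¹ := by
    rw [ENNReal.ofReal_inv_of_pos (NNReal.coe_pos.2 hpos), ENNReal.ofReal_coe_nnreal]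
  have hwired : (R x y : ℝ≥0∞)⁻¹ ≤
      sInf (GR.energy '' {u | u ∈ WeightedGraph.finFun V ∧ u x = 1 ∧ u y = 0}) := by
    refine le_sInf ?_
    rintro _ ⟨u, ⟨hu, hx1, hy0⟩, rfl⟩
    refine WeightedGraph.le_energy_of_tendsto hw hlim hu (((hev x).and (hev y)).mono ?_)
    rintro n ⟨hx, hy⟩
    rw [WeightedGraph.extend_energy, ← hRinv]
    exact ENNReal.ofReal_le_ofReal ((hG n).inv_le_energyForm (hconn n) (x := ⟨x, hx⟩)
      (y := ⟨y, hy⟩) (fun h => hxy (congrArg Subtype.val h)) hx1 hy0)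
  have hfree : sInf (GR.energy '' {u | u ∈ GR.domEnergy ∧ u x = 1 ∧ u y = 0}) ≤
      (R x y : ℝ≥0∞)⁻¹ := by
    have hr : (R x y : ℝ) ≠ 0 := NNReal.coe_ne_zero.2 hpos.ne'
    -- The potential has energy `R x y` in each `G n` containing both points, so division by `R x y`
    -- normalizes its value at `x` to `1` and its energy to `1/R x y`.
    have hE : GR.energy (fun z => (R x y : ℝ)⁻¹ * WeightedGraph.potential R x y z) ≤
        (R x y : ℝ≥0∞)⁻¹ := by
      refine WeightedGraph.energy_le_of_tendsto hw (((hev x).and (hev y)).mono ?_)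
      rintro n ⟨hx, hy⟩
      have h1 : (G n).energyForm (fun z => WeightedGraph.potential R x y z)
          (fun z => WeightedGraph.potential R x y z) = R x y := (hG n).energyForm_potential_self (hconn n) ⟨x, hx⟩ ⟨y, hy⟩
      have h2 : (G n).energyForm (fun z => (R x y : ℝ)⁻¹ * WeightedGraph.potential R x y z)
          (fun z => (R x y : ℝ)⁻¹ * WeightedGraph.potential R x y z) = (R x y : ℝ)⁻¹ ^ 2 *
          (G n).energyForm (fun z => WeightedGraph.potential R x y z)
            (fun z => WeightedGraph.potential R x y z) := by
        simp only [WeightedGraph.energyForm, Finset.mul_sum]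
        exact Finset.sum_congr rfl fun z _ => Finset.sum_congr rfl fun w _ => by ring
      rw [WeightedGraph.extend_energy, h2, h1, ← hRinv]
      refine le_of_eq (congrArg _ ?_)
      field_simp
    refine le_trans (sInf_le ⟨fun z => (R x y : ℝ)⁻¹ * WeightedGraph.potential R x y z,
      ⟨?_, ?_, ?_⟩, rfl⟩) hE
    · exact hE.trans_lt (by simpa using hpos)
    · dsimp only
      rw [WeightedGraph.potential_apply_left R (hself x), inv_mul_cancel₀ hr]
    · dsimp only
      rw [WeightedGraph.potential_apply_right R (hself y), mul_zero]
  have hcut : sInf (GR.energy '' {u | u ∈ WeightedGraph.finFun V ∧ u x = 1 ∧ u y = 0}) ≤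
      sInf (GR.energy '' {u | u ∈ GR.domEnergy ∧ u x = 1 ∧ u y = 0}) := by
    obtain ⟨f, hfx, hf0, hf1, hfW, hf⟩ :=
      GR.exists_finite_support_tendsto_energy hVn hfin x (hrec x)
    refine le_sInf ?_
    rintro _ ⟨u, ⟨hu, hx1, hy0⟩, rfl⟩
    exact WeightedGraph.sInf_energy_finFun_le hfx hf0 hf1 hfW hf hu hx1 hy0
  constructor
  · rw [WeightedGraph.freeResistance, WeightedGraph.resistanceOn,
      le_antisymm hfree (hwired.trans hcut), inv_inv]
  · rw [WeightedGraph.wiredResistance, WeightedGraph.resistanceOn,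
      le_antisymm (hcut.trans hfree) hwired, inv_inv]
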